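/- **Theorem.** For $D\in\mathbb N$ let $\mathbb B^D=\{x\in\mathbb R^D:\|x\|<1\}$ be the Poincaré ball, with the hyperbolic metric $$d_H(u,v)=\operatorname{arcosh}\left(1+\frac{2\|u-v\|^2}{(1-\|u\|^2)(1-\|v\|^2)}\right),$$ where $\|\cdot\|$ is the Euclidean norm. For a finite non-empty set $P\subset\mathbb B^D$ and $q\in\mathbb B^D$, let $f_P(q)$ denote a point of $P$ that is farthest from $q$, that is, $d_H(q,f_P(q))=\max_{p\in P}d_H(q,p)$. Fix the dimension $D$. There are a constant $C>0$ and an algorithm, both depending only on $D$, such that the following holds. Given any $\varepsilon$ with $0<\varepsilon<1$ and any set $P$ of $n\ge 1$ points in $\mathbb B^D$ (listed in an array in any order), the algorithm computes in at most $C\,n/\varepsilon^D$ time a subset $P_\varepsilon\subset P$ of size $|P_\varepsilon|\le C/\varepsilon^D$, given as an array of at most $C/\varepsilon^D$ indices of points of $P$. For every query point $q\in\mathbb B^D$ there is a point $p_\varepsilon\in P_\varepsilon$ such that $$d_H(q,p_\varepsilon)\ge d_H(q,f_P(q))-\varepsilon\qquad\text{and}\qquad d_H(q,p_\varepsilon)\ge(1-\varepsilon)\,d_H(q,f_P(q)).$$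 Time is the number of elementary steps on a real RAM: unit-cost operations $+,-,\times,/,\sqrt{\cdot}$ and comparisons on exact real numbers; addition, truncated subtraction and comparisons on natural numbers; conversion of natural numbers to reals; indirect array access with natural-number indices; natural-number and rational constants; and no floor function. -/

import Mathlib

/-- The Poincaré ball: the open unit ball of `ℝ^D` with the Euclidean norm. -/
abbrev PoincareBall (D : ℕ) : Type :=
  Metric.ball (0 : EuclideanSpace ℝ (Fin D)) 1

/-- The hyperbolic distance of the Poincaré ball model. -/
noncomputable def hypDist {D : ℕ} (u v : PoincareBall D) : ℝ :=
  Real.arcosh (1 + 2 * ‖(u : EuclideanSpace ℝ (Fin D)) - v‖ ^ 2 /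
    ((1 - ‖(u : EuclideanSpace ℝ (Fin D))‖ ^ 2) * (1 - ‖(v : EuclideanSpace ℝ (Fin D))‖ ^ 2)))

/-- `f` is a point of `P` that is farthest from `q`. -/
def IsFarthest {D : ℕ} (P : Set (PoincareBall D)) (q f : PoincareBall D) : Prop :=
  f ∈ P ∧ ∀ p ∈ P, hypDist q p ≤ hypDist q f

/-! ### The real RAM

Programs for a real RAM without rounding: unit-cost arithmetic `+, -, *, /, √` and comparisons on
exact real numbers; `+`, truncated `-` and comparisons on natural numbers, which are also used as
array indices; conversion of a natural number to a real one. The only constants are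
natural and rational literals. There is no conversion from reals to integers (no floor). -/

namespace RealRAM

/-- The memory: scalar variables and arrays of both types. A program mentions
only finitely many variable names and array names; array cells are addressed indirectly. -/
structure State where
  natVar : ℕ → ℕ
  realVar : ℕ → ℝ
  natArr : ℕ → ℕ → ℕ
  realArr : ℕ → ℕ → ℝ

/-- Expressions of integer type. -/
inductive NExp : Type
  | lit (k : ℕ)
  | var (x : ℕ)
  | get (a : ℕ) (i : NExp)
  | add (e f : NExp)
  | sub (e f : NExp)

/-- Expressions of real type. -/
inductive RExp : Type
  | lit (c : ℚ)
  | var (x : ℕ)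
  | get (a : ℕ) (i : NExp)
  | ofNat (e : NExp)
  | add (e f : RExp)
  | sub (e f : RExp)
  | mul (e f : RExp)
  | div (e f : RExp)
  | sqrt (e : RExp)

/-- Tests. -/
inductive BExp : Type
  | natLe (e f : NExp)
  | realLe (e f : RExp)
  | not (b : BExp)
  | and (b c : BExp)

/-- Programs. -/
inductive Cmd : Type
  | skip
  | setNat (x : ℕ) (e : NExp)
  | setReal (x : ℕ) (e : RExp)
  | putNat (a : ℕ) (i : NExp) (e : NExp)
  | putReal (a : ℕ) (i : NExp) (e : RExp)
  | seq (c d : Cmd)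
  | ite (b : BExp) (c d : Cmd)
  | while (b : BExp) (c : Cmd)

def NExp.eval (s : State) : NExp → ℕ
  | .lit k => k
  | .var x => s.natVar x
  | .get a i => s.natArr a (i.eval s)
  | .add e f => e.eval s + f.eval s
  | .sub e f => e.eval s - f.eval s

/-- Number of elementary operations in the evaluation of an expression. -/
def NExp.cost : NExp → ℕ
  | .lit _ => 1
  | .var _ => 1
  | .get _ i => i.cost + 1
  | .add e f => e.cost + f.cost + 1
  | .sub e f => e.cost + f.cost + 1

/-- Division by `0` and the square root of a negative number return `0`; a program could detect
both cases by a comparison, so this convention adds no power. -/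
noncomputable def RExp.eval (s : State) : RExp → ℝ
  | .lit c => (c : ℝ)
  | .var x => s.realVar x
  | .get a i => s.realArr a (i.eval s)
  | .ofNat e => (e.eval s : ℝ)
  | .add e f => e.eval s + f.eval s
  | .sub e f => e.eval s - f.eval s
  | .mul e f => e.eval s * f.eval s
  | .div e f => e.eval s / f.eval s
  | .sqrt e => Real.sqrt (e.eval s)

def RExp.cost : RExp → ℕ
  | .lit _ => 1
  | .var _ => 1
  | .get _ i => i.cost + 1
  | .ofNat e => e.cost + 1
  | .add e f => e.cost + f.cost + 1
  | .sub e f => e.cost + f.cost + 1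
  | .mul e f => e.cost + f.cost + 1
  | .div e f => e.cost + f.cost + 1
  | .sqrt e => e.cost + 1

def BExp.holds (s : State) : BExp → Prop
  | .natLe e f => e.eval s ≤ f.eval s
  | .realLe e f => e.eval s ≤ f.eval s
  | .not b => ¬ b.holds s
  | .and b c => b.holds s ∧ c.holds s

def BExp.cost : BExp → ℕ
  | .natLe e f => e.cost + f.cost + 1
  | .realLe e f => e.cost + f.cost + 1
  | .not b => b.cost + 1
  | .and b c => b.cost + c.cost + 1

def State.setNat (s : State) (x v : ℕ) : State :=
  { s with natVar := Function.update s.natVar x v }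

noncomputable def State.setReal (s : State) (x : ℕ) (v : ℝ) : State :=
  { s with realVar := Function.update s.realVar x v }

def State.putNat (s : State) (a i v : ℕ) : State :=
  { s with natArr := Function.update s.natArr a (Function.update (s.natArr a) i v) }

noncomputable def State.putReal (s : State) (a i : ℕ) (v : ℝ) : State :=
  { s with realArr := Function.update s.realArr a (Function.update (s.realArr a) i v) }

/-- `Exec c s t s'`: started in memory `s`, the program `c` halts after exactly `t` elementary
steps, in memory `s'`. -/
inductive Exec : Cmd → State → ℕ → State → Prop
  | skip (s : State) : Exec .skip s 1 s
  | setNat (s : State) (x : ℕ) (e : NExp) :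
      Exec (.setNat x e) s (e.cost + 1) (s.setNat x (e.eval s))
  | setReal (s : State) (x : ℕ) (e : RExp) :
      Exec (.setReal x e) s (e.cost + 1) (s.setReal x (e.eval s))
  | putNat (s : State) (a : ℕ) (i e : NExp) :
      Exec (.putNat a i e) s (i.cost + e.cost + 1) (s.putNat a (i.eval s) (e.eval s))
  | putReal (s : State) (a : ℕ) (i : NExp) (e : RExp) :
      Exec (.putReal a i e) s (i.cost + e.cost + 1) (s.putReal a (i.eval s) (e.eval s))
  | seq {c d : Cmd} {s s₁ s₂ : State} {t₁ t₂ : ℕ} :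
      Exec c s t₁ s₁ → Exec d s₁ t₂ s₂ → Exec (.seq c d) s (t₁ + t₂) s₂
  | ite_true {b : BExp} {c d : Cmd} {s s₁ : State} {t : ℕ} :
      b.holds s → Exec c s t s₁ → Exec (.ite b c d) s (b.cost + t + 1) s₁
  | ite_false {b : BExp} {c d : Cmd} {s s₁ : State} {t : ℕ} :
      ¬ b.holds s → Exec d s t s₁ → Exec (.ite b c d) s (b.cost + t + 1) s₁
  | while_true {b : BExp} {c : Cmd} {s s₁ s₂ : State} {t₁ t₂ : ℕ} :
      b.holds s → Exec c s t₁ s₁ → Exec (.while b c) s₁ t₂ s₂ →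
        Exec (.while b c) s (b.cost + t₁ + t₂ + 1) s₂
  | while_false {b : BExp} {c : Cmd} {s : State} :
      ¬ b.holds s → Exec (.while b c) s (b.cost + 1) s

/-- Programs are deterministic: the running time and the final memory are unique. -/
theorem Exec.unique {c : Cmd} {s s₁ s₂ : State} {t₁ t₂ : ℕ}
    (h₁ : Exec c s t₁ s₁) (h₂ : Exec c s t₂ s₂) : t₁ = t₂ ∧ s₁ = s₂ := by
  induction h₁ generalizing t₂ s₂ with
  | skip s => cases h₂; exact ⟨rfl, rfl⟩
  | setNat s x e => cases h₂; exact ⟨rfl, rfl⟩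
  | setReal s x e => cases h₂; exact ⟨rfl, rfl⟩
  | putNat s a i e => cases h₂; exact ⟨rfl, rfl⟩
  | putReal s a i e => cases h₂; exact ⟨rfl, rfl⟩
  | seq _ _ ih₁ ih₂ =>
    cases h₂ with
    | seq g₁ g₂ =>
      obtain ⟨rfl, rfl⟩ := ih₁ g₁
      obtain ⟨rfl, rfl⟩ := ih₂ g₂
      exact ⟨rfl, rfl⟩
  | ite_true hb _ ih =>
    cases h₂ with
    | ite_true _ g => obtain ⟨rfl, rfl⟩ := ih g; exact ⟨rfl, rfl⟩
    | ite_false hb' _ => exact absurd hb hb'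
  | ite_false hb _ ih =>
    cases h₂ with
    | ite_true hb' _ => exact absurd hb' hb
    | ite_false _ g => obtain ⟨rfl, rfl⟩ := ih g; exact ⟨rfl, rfl⟩
  | while_true hb _ _ ih₁ ih₂ =>
    cases h₂ with
    | while_true _ g₁ g₂ =>
      obtain ⟨rfl, rfl⟩ := ih₁ g₁
      obtain ⟨rfl, rfl⟩ := ih₂ g₂
      exact ⟨rfl, rfl⟩
    | while_false hb' => exact absurd hb hb'
  | while_false hb =>
    cases h₂ with
    | while_true hb' _ _ => exact absurd hb' hb
    | while_false _ => exact ⟨rfl, rfl⟩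

/-- The input memory: integer variable `0` holds `n`, real variable `0` holds `ε`, and for `j < D`
real array `j` holds the `j`-th coordinates of the points `p 0, …, p (n - 1)`. All other cells
hold `0`. -/
noncomputable def input {D n : ℕ} (p : Fin n → PoincareBall D) (ε : ℝ) : State where
  natVar x := if x = 0 then n else 0
  realVar x := if x = 0 then ε else 0
  natArr _ _ := 0
  realArr j i :=
    if h : j < D ∧ i < n then (p ⟨i, h.2⟩ : EuclideanSpace ℝ (Fin D)) ⟨j, h.1⟩ else 0

/-- The final memory `s` outputs the list `out` of input indices: integer variable `0` holds the
length of the list, and integer array `0` holds its entries. -/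
def Outputs {n : ℕ} (s : State) (out : List (Fin n)) : Prop :=
  s.natVar 0 = out.length ∧ ∀ j : Fin out.length, s.natArr 0 j = (out.get j : ℕ)

end RealRAM

/-! Put s(u,v) = sinh(d(u,v)/2). Its square `sinhHalfSq` is increasing in d and rational in the
coordinates, so a real RAM can compare distances without `arcosh`. A relative loss of ε/4 in s²
costs at most ε in d, both additively and relatively (`hypDist_approx`). It remains to approximate
s² from a query to its farthest point.

Let a be a point of P farthest from an arbitrary o in P, and b a point of P farthest from a.
Ptolemy's inequality, which s inherits from Euclidean distance, gives s(p,b) ≤ 2 s(a,b) for all p in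
P (`sinhHalfSq_le_four_mul`). The triangle inequality for d would not do: doubling d multiplies s by
an unbounded factor.

Use the hyperboloid model centred at the midpoint of a and b, with time coordinate T and space
coordinates x in ℝ^D. With σ = s(a,b), all of P satisfies ‖x‖ ≤ 5σ, so a volume argument bounds any
(ε/44)σ-separated subset by (441/ε)^D points (`length_le_of_frameDistSq_separated`). For a query q,
1 + 2s(q,p)² = T_q T_p - ⟨x_q, x_p⟩, and moving x_p by at most (ε/44)σ decreases s(q,p)² by at most
the fraction ε/4 if p is at least as far from q as a and b are (`sinhHalfSq_ge_of_frameDistSq_le`).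
A greedy net therefore suffices. It needs no grid, hence no floor, and only the distances of the x,
which are rational in s² (`frameDistSq`). -/

/-! ### The square of `sinh (d / 2)` for the hyperbolic distance `d` -/

/-- The square of `sinh (d / 2)`, where `d` is the hyperbolic distance of `u` and `v`. -/
noncomputable def sinhHalfSq {D : ℕ} (u v : PoincareBall D) : ℝ :=
  ‖(u : EuclideanSpace ℝ (Fin D)) - v‖ ^ 2 /
    ((1 - ‖(u : EuclideanSpace ℝ (Fin D))‖ ^ 2) * (1 - ‖(v : EuclideanSpace ℝ (Fin D))‖ ^ 2))

namespace PoincareBall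

variable {D : ℕ}

theorem one_sub_norm_sq_pos (u : PoincareBall D) :
    0 < 1 - ‖(u : EuclideanSpace ℝ (Fin D))‖ ^ 2 := by
  have h : ‖(u : EuclideanSpace ℝ (Fin D))‖ < 1 := mem_ball_zero_iff.1 u.2
  nlinarith [norm_nonneg (u : EuclideanSpace ℝ (Fin D))]

theorem sinhHalfSq_nonneg (u v : PoincareBall D) : 0 ≤ sinhHalfSq u v :=
  div_nonneg (sq_nonneg _) (mul_pos (one_sub_norm_sq_pos u) (one_sub_norm_sq_pos v)).le

theorem sinhHalfSq_comm (u v : PoincareBall D) : sinhHalfSq u v = sinhHalfSq v u := by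
  rw [sinhHalfSq, sinhHalfSq, norm_sub_rev, mul_comm (1 - _)]

@[simp] theorem sinhHalfSq_self (u : PoincareBall D) : sinhHalfSq u u = 0 := by
  simp [sinhHalfSq]

theorem eq_of_sinhHalfSq_eq_zero {u v : PoincareBall D} (h : sinhHalfSq u v = 0) : u = v := by
  rw [sinhHalfSq, div_eq_zero_iff, or_iff_left
    (mul_pos (one_sub_norm_sq_pos u) (one_sub_norm_sq_pos v)).ne'] at h
  exact Subtype.ext (sub_eq_zero.1 (norm_eq_zero.1 (pow_eq_zero_iff two_ne_zero |>.1 h)))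

theorem hypDist_eq (u v : PoincareBall D) :
    hypDist u v = Real.arcosh (1 + 2 * sinhHalfSq u v) := by
  rw [hypDist, sinhHalfSq, mul_div_assoc]

theorem hypDist_nonneg (u v : PoincareBall D) : 0 ≤ hypDist u v := by
  rw [hypDist_eq]
  exact Real.arcosh_nonneg (by linarith [sinhHalfSq_nonneg u v])

theorem sinh_half_hypDist_sq (u v : PoincareBall D) :
    Real.sinh (hypDist u v / 2) ^ 2 = sinhHalfSq u v := by
  have h := Real.cosh_arcosh (x := 1 + 2 * sinhHalfSq u v) (by linarith [sinhHalfSq_nonneg u v])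
  rw [← hypDist_eq] at h
  have h2 := Real.cosh_two_mul (hypDist u v / 2)
  rw [mul_div_cancel₀ _ two_ne_zero, h] at h2
  linarith [Real.cosh_sq (hypDist u v / 2)]

/-- `arcosh` is monotone on [1, ∞), so farthest points are the same for both quantities. -/
theorem hypDist_le_hypDist_iff (a b c d : PoincareBall D) :
    hypDist a b ≤ hypDist c d ↔ sinhHalfSq a b ≤ sinhHalfSq c d := by
  rw [hypDist_eq, hypDist_eq, Real.arcosh_le_arcosh (by linarith [sinhHalfSq_nonneg a b])
    (by linarith [sinhHalfSq_nonneg c d])]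
  constructor <;> intro h <;> linarith

end PoincareBall

/-! ### From errors in sinh to errors in the distance -/

/-- Convexity of sinh on [0, ∞) together with sinh 0 = 0; this yields the relative error. -/
theorem Real.sinh_mul_le {r x : ℝ} (hr0 : 0 ≤ r) (hr1 : r ≤ 1) (hx : 0 ≤ x) :
    Real.sinh (r * x) ≤ r * Real.sinh x := by
  have hc : ConvexOn ℝ (Set.Ici 0) Real.sinh := by
    refine MonotoneOn.convexOn_of_deriv (convex_Ici 0) Real.continuous_sinh.continuousOn
      Real.differentiable_sinh.differentiableOn ?_
    rw [Real.deriv_sinh, interior_Ici]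
    intro a ha b hb hab
    rw [Real.cosh_le_cosh, abs_of_pos ha, abs_of_pos hb]
    exact hab
  have h := hc.2 (Set.mem_Ici.2 hx) (Set.mem_Ici.2 le_rfl) hr0 (sub_nonneg.2 hr1) (by ring)
  simpa using h

/-- Addition formula, with cosh x replaced by the smaller sinh x; this yields the additive error. -/
theorem Real.sinh_sub_le {x t : ℝ} (ht : 0 ≤ t) :
    Real.sinh (x - t) ≤ Real.exp (-t) * Real.sinh x := by
  have h1 : 0 ≤ Real.sinh t := Real.sinh_nonneg_iff.2 ht
  have h2 : Real.sinh x ≤ Real.cosh x := (Real.sinh_lt_cosh x).le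
  have h3 : Real.exp (-t) = Real.cosh t - Real.sinh t := (Real.cosh_sub_sinh t).symm
  rw [Real.sinh_sub, h3]
  nlinarith

namespace PoincareBall

variable {D : ℕ}

/-- A relative error in `sinh (d / 2) ^ 2` bounds both the additive and the relative error in the
distance `d`. -/
theorem hypDist_approx {ε : ℝ} (h0 : 0 < ε) (h1 : ε < 1) {q f p : PoincareBall D}
    (h : (1 - ε / 4) * sinhHalfSq q f ≤ sinhHalfSq q p) :
    hypDist q f - ε ≤ hypDist q p ∧ (1 - ε) * hypDist q f ≤ hypDist q p := by
  have hd := hypDist_nonneg q f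
  have hd' := hypDist_nonneg q p
  rw [← sinh_half_hypDist_sq, ← sinh_half_hypDist_sq] at h
  set d := hypDist q f
  set d' := hypDist q p
  have hs : 0 ≤ Real.sinh (d / 2) := Real.sinh_nonneg_iff.2 (by linarith)
  have hs' : 0 ≤ Real.sinh (d' / 2) := Real.sinh_nonneg_iff.2 (by linarith)
  -- The square root costs nothing, since (1 - ε/4)² ≤ 1 - ε/4.
  have key : (1 - ε / 4) * Real.sinh (d / 2) ≤ Real.sinh (d' / 2) := by
    refine abs_le_of_sq_le_sq' ?_ hs' |>.2
    nlinarith [sq_nonneg (Real.sinh (d / 2)),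
      mul_nonneg (mul_nonneg h0.le (by linarith : 0 ≤ 1 - ε / 4)) (sq_nonneg (Real.sinh (d / 2)))]
  constructor
  · have hexp : Real.exp (-(ε / 2)) ≤ 1 - ε / 4 := by
      rw [Real.exp_neg]
      refine inv_le_of_inv_le₀ (by linarith) ?_
      rw [inv_le_iff_one_le_mul₀ (by linarith)]
      nlinarith [Real.add_one_le_exp (ε / 2)]
    have := (Real.sinh_sub_le (x := d / 2) (t := ε / 2) (by linarith)).trans
      ((mul_le_mul_of_nonneg_right hexp hs).trans key)
    linarith [Real.sinh_le_sinh.1 this]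
  · have := (Real.sinh_mul_le (r := 1 - ε / 4) (x := d / 2) (by linarith) (by linarith)
      (by linarith)).trans key
    nlinarith [Real.sinh_le_sinh.1 this]

/-- Ptolemy's inequality for `sinh (d / 2)`. -/
theorem ptolemy (a b c d : PoincareBall D) :
    √(sinhHalfSq a c) * √(sinhHalfSq b d) ≤
      √(sinhHalfSq a b) * √(sinhHalfSq c d) + √(sinhHalfSq b c) * √(sinhHalfSq a d) := by
  have key : ∀ u v : PoincareBall D, √(sinhHalfSq u v) =
      dist (u : EuclideanSpace ℝ (Fin D)) v / (√(1 - ‖(u : EuclideanSpace ℝ (Fin D))‖ ^ 2) *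
        √(1 - ‖(v : EuclideanSpace ℝ (Fin D))‖ ^ 2)) := fun u v ↦ by
    rw [sinhHalfSq, Real.sqrt_div (sq_nonneg _), Real.sqrt_sq (norm_nonneg _),
      Real.sqrt_mul (one_sub_norm_sq_pos u).le, dist_eq_norm]
  have hpos : ∀ u : PoincareBall D, 0 < √(1 - ‖(u : EuclideanSpace ℝ (Fin D))‖ ^ 2) :=
    fun u ↦ Real.sqrt_pos.2 (one_sub_norm_sq_pos u)
  have h := EuclideanGeometry.mul_dist_le_mul_dist_add_mul_dist
    (a : EuclideanSpace ℝ (Fin D)) b c d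
  rw [key, key, key, key, key, key]
  have ha := hpos a
  have hb := hpos b
  have hc := hpos c
  have hd := hpos d
  set wa := √(1 - ‖(a : EuclideanSpace ℝ (Fin D))‖ ^ 2)
  set wb := √(1 - ‖(b : EuclideanSpace ℝ (Fin D))‖ ^ 2)
  set wc := √(1 - ‖(c : EuclideanSpace ℝ (Fin D))‖ ^ 2)
  set wd := √(1 - ‖(d : EuclideanSpace ℝ (Fin D))‖ ^ 2)
  -- Each of the four points occurs once in every product, so all three products carry the same
  -- conformal factor and the Euclidean inequality can be divided by it.
  refine le_of_eq_of_le (b := (dist (a : EuclideanSpace ℝ (Fin D)) c *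
    dist (b : EuclideanSpace ℝ (Fin D)) d) / (wa * wb * wc * wd)) (by field_simp) ?_
  refine (div_le_div_of_nonneg_right h (by positivity)).trans_eq ?_
  field_simp

/-- Ptolemy for p, a, b, o: s(p,b) s(a,o) ≤ s(p,a) s(b,o) + s(a,b) s(p,o) ≤ 2 s(a,b) s(a,o).
Cancelling s(a,o) is why a must be extremal for some o. -/
theorem sinhHalfSq_le_four_mul {o a b p : PoincareBall D} (hp : sinhHalfSq p o ≤ sinhHalfSq a o)
    (hb : sinhHalfSq b o ≤ sinhHalfSq a o) (hpa : sinhHalfSq p a ≤ sinhHalfSq b a) :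
    sinhHalfSq p b ≤ 4 * sinhHalfSq a b := by
  rcases (sinhHalfSq_nonneg a o).eq_or_lt with h0 | h0
  · have h1 := eq_of_sinhHalfSq_eq_zero (le_antisymm (hp.trans h0.ge) (sinhHalfSq_nonneg p o))
    have h2 := eq_of_sinhHalfSq_eq_zero (le_antisymm (hb.trans h0.ge) (sinhHalfSq_nonneg b o))
    rw [h1, h2, sinhHalfSq_self]
    exact mul_nonneg (by norm_num) (sinhHalfSq_nonneg a o)
  · have h := ptolemy p a b o
    rw [sinhHalfSq_comm b a] at hpa
    have e1 := mul_le_mul (Real.sqrt_le_sqrt hpa) (Real.sqrt_le_sqrt hb) (Real.sqrt_nonneg _)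
      (Real.sqrt_nonneg _)
    have e2 := mul_le_mul_of_nonneg_left (Real.sqrt_le_sqrt hp) (Real.sqrt_nonneg (sinhHalfSq a b))
    have e3 : √(sinhHalfSq p b) ≤ 2 * √(sinhHalfSq a b) :=
      le_of_mul_le_mul_right (by linarith) (Real.sqrt_pos.2 h0)
    have e4 := pow_le_pow_left₀ (Real.sqrt_nonneg _) e3 2
    rw [mul_pow, Real.sq_sqrt (sinhHalfSq_nonneg _ _), Real.sq_sqrt (sinhHalfSq_nonneg _ _)] at e4
    linarith

/-! ### Hyperboloid coordinates centred at the midpoint of two points -/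

/-- Time coordinate on the hyperboloid in the frame of the midpoint of `a` and `b`: the hyperbolic
cosine of the distance to that midpoint. -/
noncomputable def frameTime (a b u : PoincareBall D) : ℝ :=
  (1 + sinhHalfSq u a + sinhHalfSq u b) / √(1 + sinhHalfSq a b)

/-- Squared distance of the space coordinates of `u` and `v` on the hyperboloid in the frame of the
midpoint of `a` and `b`. -/
noncomputable def frameDistSq (a b u v : PoincareBall D) : ℝ :=
  4 * sinhHalfSq u v + (sinhHalfSq u a + sinhHalfSq u b - (sinhHalfSq v a + sinhHalfSq v b)) *
    (sinhHalfSq u a + sinhHalfSq u b - (sinhHalfSq v a + sinhHalfSq v b)) / (1 + sinhHalfSq a b)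

theorem frameDistSq_self (a b u : PoincareBall D) : frameDistSq a b u u = 0 := by
  simp [frameDistSq]

/-- Hyperboloid coordinates centred at the origin of the ball. -/
theorem hyperboloid_inner (u v : PoincareBall D) :
    (2 / (1 - ‖(u : EuclideanSpace ℝ (Fin D))‖ ^ 2) - 1) *
      (2 / (1 - ‖(v : EuclideanSpace ℝ (Fin D))‖ ^ 2) - 1) -
      inner ℝ ((2 / (1 - ‖(u : EuclideanSpace ℝ (Fin D))‖ ^ 2)) • (u : EuclideanSpace ℝ (Fin D)))
        ((2 / (1 - ‖(v : EuclideanSpace ℝ (Fin D))‖ ^ 2)) • (v : EuclideanSpace ℝ (Fin D))) =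
      1 + 2 * sinhHalfSq u v := by
  have hu := (one_sub_norm_sq_pos u).ne'
  have hv := (one_sub_norm_sq_pos v).ne'
  rw [real_inner_smul_left, real_inner_smul_right, sinhHalfSq, norm_sub_sq_real]
  field_simp
  ring

/-- Some isometry of the hyperboloid moves the midpoint of a and b to the base point, and it
preserves the Minkowski product. -/
theorem exists_frame (a b : PoincareBall D) :
    ∃ x : PoincareBall D → EuclideanSpace ℝ (Fin D), ∀ u v : PoincareBall D,
      frameTime a b u * frameTime a b v - inner ℝ (x u) (x v) = 1 + 2 * sinhHalfSq u v := by
  obtain ⟨t, w, htw, ht⟩ : ∃ (t : PoincareBall D → ℝ)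
      (w : PoincareBall D → EuclideanSpace ℝ (Fin D)),
      (∀ u v, t u * t v - inner ℝ (w u) (w v) = 1 + 2 * sinhHalfSq u v) ∧ ∀ u, 0 < t u := by
    refine ⟨_, _, hyperboloid_inner, fun u ↦ ?_⟩
    rw [sub_pos, one_lt_div (one_sub_norm_sq_pos u)]
    nlinarith [sq_nonneg ‖(u : EuclideanSpace ℝ (Fin D))‖]
  set B := √(1 + sinhHalfSq a b)
  have hB : 0 < B := Real.sqrt_pos.2 (by linarith [sinhHalfSq_nonneg a b])
  have hB2 : B ^ 2 = 1 + sinhHalfSq a b := Real.sq_sqrt (by linarith [sinhHalfSq_nonneg a b])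
  -- The midpoint is the sum of the two hyperboloid vectors, normalised: its Minkowski square is 2 +
  -- 2 cosh d(a,b) = 4B², where B = cosh(d(a,b)/2).
  set c₀ : ℝ := (t a + t b) / (2 * B) with hc₀
  set c : EuclideanSpace ℝ (Fin D) := (1 / (2 * B)) • (w a + w b) with hc
  have hc₀pos : 0 < 1 + c₀ := by have := ht a; have := ht b; positivity
  have hg : ∀ u, frameTime a b u = t u * c₀ - inner ℝ (w u) c := fun u ↦ by
    rw [frameTime, hc, hc₀, real_inner_smul_right, inner_add_right,
      show inner ℝ (w u) (w a) = t u * t a - (1 + 2 * sinhHalfSq u a) by linarith [htw u a],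
      show inner ℝ (w u) (w b) = t u * t b - (1 + 2 * sinhHalfSq u b) by linarith [htw u b]]
    change _ / B = _
    field_simp
    ring
  have hcc : inner ℝ c c = c₀ ^ 2 - 1 := by
    have haa := htw a a
    have hbb := htw b b
    have hab := htw a b
    rw [sinhHalfSq_self] at haa hbb
    rw [hc, real_inner_smul_right, real_inner_smul_left, inner_add_left, inner_add_right,
      inner_add_right, real_inner_comm (w a) (w b), hc₀]
    field_simp
    rw [hB2]
    linear_combination -haa - hbb - 2 * hab
  clear_value c c₀
  -- Space part of the half-turn that swaps the base point and (c₀, c). Unlike for a reflection, the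
  -- denominator never vanishes.
  refine ⟨fun u ↦ ((frameTime a b u + t u) / (1 + c₀)) • c - w u, fun u v ↦ ?_⟩
  rw [← htw u v, inner_sub_left, inner_sub_right, inner_sub_right, real_inner_smul_left,
    real_inner_smul_left, real_inner_smul_right, real_inner_smul_right, hcc,
    real_inner_comm (w v) c, show inner ℝ (w u) c = t u * c₀ - frameTime a b u by linarith [hg u],
    show inner ℝ (w v) c = t v * c₀ - frameTime a b v by linarith [hg v]]
  field_simp
  ring

theorem norm_sub_sq_frame {a b : PoincareBall D} {x : PoincareBall D → EuclideanSpace ℝ (Fin D)}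
    (hx : ∀ u v, frameTime a b u * frameTime a b v - inner ℝ (x u) (x v) = 1 + 2 * sinhHalfSq u v)
    (u v : PoincareBall D) : ‖x u - x v‖ ^ 2 = frameDistSq a b u v := by
  have huu := hx u u
  have hvv := hx v v
  have huv := hx u v
  rw [sinhHalfSq_self, real_inner_self_eq_norm_sq] at huu hvv
  have hB : 0 < 1 + sinhHalfSq a b := by linarith [sinhHalfSq_nonneg a b]
  have hg : (frameTime a b u - frameTime a b v) ^ 2 =
      (sinhHalfSq u a + sinhHalfSq u b - (sinhHalfSq v a + sinhHalfSq v b)) *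
    (sinhHalfSq u a + sinhHalfSq u b - (sinhHalfSq v a + sinhHalfSq v b)) /
      (1 + sinhHalfSq a b) := by
    rw [frameTime, frameTime, ← sub_div, div_pow, Real.sq_sqrt hB.le]
    ring
  rw [norm_sub_sq_real, frameDistSq, ← hg]
  linear_combination -huu - hvv + 2 * huv

/-- With S = σ², T² ≤ (1 + 5S)²/(1 + S) ≤ 1 + 25S, and ‖x‖² = T² - 1. -/
theorem norm_sq_frame_le {a b u : PoincareBall D}
    {x : PoincareBall D → EuclideanSpace ℝ (Fin D)}
    (hx : ∀ u v, frameTime a b u * frameTime a b v - inner ℝ (x u) (x v) = 1 + 2 * sinhHalfSq u v)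
    (ha : sinhHalfSq u a ≤ sinhHalfSq a b) (hb : sinhHalfSq u b ≤ 4 * sinhHalfSq a b) :
    ‖x u‖ ^ 2 ≤ 25 * sinhHalfSq a b := by
  have huu := hx u u
  rw [sinhHalfSq_self, real_inner_self_eq_norm_sq] at huu
  have h0 := sinhHalfSq_nonneg a b
  have h1 := sinhHalfSq_nonneg u a
  have h2 := sinhHalfSq_nonneg u b
  have hB : 0 < 1 + sinhHalfSq a b := by linarith
  have h : frameTime a b u ^ 2 ≤ 1 + 25 * sinhHalfSq a b := by
    rw [frameTime, div_pow, Real.sq_sqrt hB.le, div_le_iff₀ hB]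
    nlinarith
  nlinarith

/-- Points that are close in the frame of `a` and `b` are interchangeable as farthest points. -/
theorem sinhHalfSq_ge_of_frameDistSq_le {ε : ℝ} (hε : 0 < ε) {a b q p p' : PoincareBall D}
    (ha : sinhHalfSq p a ≤ sinhHalfSq a b) (hb : sinhHalfSq p b ≤ 4 * sinhHalfSq a b)
    (ha' : sinhHalfSq p' a ≤ sinhHalfSq a b) (hb' : sinhHalfSq p' b ≤ 4 * sinhHalfSq a b)
    (hqa : sinhHalfSq q a ≤ sinhHalfSq q p) (hqb : sinhHalfSq q b ≤ sinhHalfSq q p)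
    (hpp : frameDistSq a b p p' ≤ (ε / 44) ^ 2 * sinhHalfSq a b) :
    (1 - ε / 4) * sinhHalfSq q p ≤ sinhHalfSq q p' := by
  obtain ⟨x, hx⟩ := exists_frame a b
  have hF := sinhHalfSq_nonneg a b
  have hX := norm_sq_frame_le hx ha hb
  have hX' := norm_sq_frame_le hx ha' hb'
  have hqp := hx q p
  have hqp' := hx q p'
  have hpos : ∀ u, 0 < frameTime a b u := fun u ↦ by
    have := sinhHalfSq_nonneg u a
    have := sinhHalfSq_nonneg u b
    exact div_pos (by linarith) (Real.sqrt_pos.2 (by linarith))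
  have hns : ∀ u, ‖x u‖ ^ 2 = frameTime a b u ^ 2 - 1 := fun u ↦ by
    have := hx u u
    rw [sinhHalfSq_self, real_inner_self_eq_norm_sq] at this
    linarith
  rw [← norm_sub_sq_frame hx] at hpp
  set B := √(1 + sinhHalfSq a b) with hBdef
  set σ := √(sinhHalfSq a b)
  have hB2 : B ^ 2 = 1 + sinhHalfSq a b := Real.sq_sqrt (by linarith)
  have hσ2 : σ ^ 2 = sinhHalfSq a b := Real.sq_sqrt hF
  have hσ : 0 ≤ σ := Real.sqrt_nonneg _
  have hB1 : 1 ≤ B := Real.one_le_sqrt.2 (by linarith)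
  -- The left side equals s(q,a)² + s(q,b)². All errors below are measured against it.
  have hAB : frameTime a b q * B - 1 ≤ 2 * sinhHalfSq q p := by
    rw [frameTime, ← hBdef, div_mul_cancel₀ _ (by linarith)]
    linarith
  have hN : ‖x p - x p'‖ ≤ ε / 44 * σ := by
    refine abs_le_of_sq_le_sq' ?_ (by positivity) |>.2
    rwa [mul_pow, hσ2]
  have hG := hpos p
  have hG' := hpos p'
  have hA1 : 1 ≤ frameTime a b q := by
    nlinarith [hns q, sq_nonneg ‖x q‖, hpos q]
  have hin : -inner ℝ (x q) (x p - x p') ≤ ‖x q‖ * ‖x p - x p'‖ :=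
    (neg_le_abs _).trans (abs_real_inner_le_norm _ _)
  rw [inner_sub_right] at hin
  have hbd : ∀ u, ‖x u‖ ^ 2 ≤ 25 * sinhHalfSq a b → ‖x u‖ * B ≤ 5 * σ * frameTime a b u := by
    intro u hu
    refine abs_le_of_sq_le_sq' ?_ (by have := hpos u; positivity) |>.2
    rw [mul_pow, mul_pow, mul_pow, hB2, hσ2,
      show frameTime a b u ^ 2 = ‖x u‖ ^ 2 + 1 by linarith [hns u]]
    nlinarith [mul_nonneg hF (sq_nonneg ‖x u‖)]
  -- T² - ‖x‖² = 1 turns a difference of times into a difference of norms, with slope at most ‖x‖/T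
  -- ≤ 5σ/B.
  have hdiff : (frameTime a b p - frameTime a b p') * B ≤ 5 * σ * ‖x p - x p'‖ := by
    have h1 : (frameTime a b p - frameTime a b p') * (frameTime a b p + frameTime a b p') ≤
        ‖x p - x p'‖ * (‖x p‖ + ‖x p'‖) := by
      have := mul_le_mul_of_nonneg_right (norm_sub_norm_le (x p) (x p'))
        (add_nonneg (norm_nonneg (x p)) (norm_nonneg (x p')))
      linarith [hns p, hns p']
    refine le_of_mul_le_mul_right ?_ (add_pos hG hG')
    have h2 := mul_le_mul_of_nonneg_right h1 (zero_le_one.trans hB1)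
    have h3 := mul_le_mul_of_nonneg_left (add_le_add (hbd p hX) (hbd p' hX'))
      (norm_nonneg (x p - x p'))
    linarith
  have hYσ : ‖x q‖ * σ ≤ frameTime a b q * B - 1 := by
    have : 0 ≤ frameTime a b q * B - 1 := by nlinarith
    refine abs_le_of_sq_le_sq' ?_ this |>.2
    rw [mul_pow, hns, hσ2, show sinhHalfSq a b = B ^ 2 - 1 by linarith]
    linarith [sq_nonneg (frameTime a b q - B)]
  have hAσ : frameTime a b q * σ ^ 2 ≤ 2 * (frameTime a b q * B - 1) * B := by
    rw [hσ2, show sinhHalfSq a b = B ^ 2 - 1 by linarith]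
    nlinarith [mul_nonneg (sub_nonneg.2 hA1) (sq_nonneg B), sq_nonneg (B - 1)]
  have hN1 := mul_le_mul_of_nonneg_left hN (norm_nonneg (x q))
  have hN2 := mul_le_mul_of_nonneg_left hN (mul_nonneg hσ (hpos q).le)
  have hd2 := mul_le_mul_of_nonneg_left hdiff (hpos q).le
  have main : (frameTime a b q * (frameTime a b p - frameTime a b p')) ≤
      10 * (ε / 44) * (frameTime a b q * B - 1) := by
    refine le_of_mul_le_mul_right ?_ (zero_lt_one.trans_le hB1)
    have := mul_le_mul_of_nonneg_left hAσ (by positivity : 0 ≤ 5 * (ε / 44))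
    linarith
  have hY := mul_le_mul_of_nonneg_left hYσ (by positivity : 0 ≤ ε / 44)
  -- The time term contributes 10 and the space term 1, so the loss in 2s² is at most 11(ε/44) = ε/4
  -- times T_q B - 1; hence the constant 44.
  have hfin := mul_le_mul_of_nonneg_left hAB (by positivity : 0 ≤ ε / 4)
  linarith

end PoincareBall

/-! ### Packing in a Euclidean ball -/

open MeasureTheory in
-- Volume comparison: the balls of radius δ/2 about the points are disjoint and lie in the ball of
-- radius R + δ/2.
theorem card_le_of_separated_of_norm_le {E : Type*} [NormedAddCommGroup E] [NormedSpace ℝ E]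
    [FiniteDimensional ℝ E] {δ R : ℝ} (hδ : 0 < δ) (hR : 0 ≤ R) (s : Finset E)
    (hs : ∀ c ∈ s, ‖c‖ ≤ R) (h : ∀ c ∈ s, ∀ d ∈ s, c ≠ d → δ ≤ ‖c - d‖) :
    (s.card : ℝ) ≤ (1 + 2 * R / δ) ^ Module.finrank ℝ E := by
  borelize E
  let μ : Measure E := Measure.addHaar
  have hδ2 : 0 < δ / 2 := half_pos hδ
  have hρ : 0 < R + δ / 2 := by positivity
  have hdisj : Set.Pairwise (s : Set E)
      (Function.onFun Disjoint fun c ↦ Metric.ball c (δ / 2)) := by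
    intro c hc d hd hcd
    apply Metric.ball_disjoint_ball
    rw [dist_eq_norm, add_halves]
    exact h c hc d hd hcd
  have hsub : (⋃ c ∈ s, Metric.ball c (δ / 2)) ⊆ Metric.ball (0 : E) (R + δ / 2) := by
    refine Set.iUnion₂_subset fun c hc ↦ Metric.ball_subset_ball' ?_
    rw [dist_zero_right]
    linarith [hs c hc]
  have hvol := measure_mono (μ := μ) hsub
  rw [measure_biUnion_finset hdisj fun c _ ↦ measurableSet_ball] at hvol
  simp only [μ.addHaar_ball_of_pos _ hδ2, μ.addHaar_ball_of_pos _ hρ, Finset.sum_const,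
    nsmul_eq_mul, ← mul_assoc] at hvol
  have hcard := ENNReal.toReal_le_of_le_ofReal (pow_nonneg hρ.le _)
    ((ENNReal.mul_le_mul_iff_left (Metric.measure_ball_pos μ _ zero_lt_one).ne'
      measure_ball_lt_top.ne).1 hvol)
  rw [ENNReal.toReal_mul, ENNReal.toReal_ofReal (pow_nonneg hδ2.le _), ENNReal.toReal_natCast,
    ← le_div_iff₀ (pow_pos hδ2 _), ← div_pow] at hcard
  rwa [show 1 + 2 * R / δ = (R + δ / 2) / (δ / 2) by field_simp; ring]

/-! ### Reasoning about programs -/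

namespace RealRAM

/-- Started in `s`, the program `c` halts within `T` steps in a memory satisfying `Q`. -/
def Runs (c : Cmd) (s : State) (T : ℕ) (Q : State → Prop) : Prop :=
  ∃ t s', Exec c s t s' ∧ t ≤ T ∧ Q s'

namespace Runs

variable {c d : Cmd} {s : State} {T T₁ T₂ : ℕ} {Q Q' : State → Prop} {b : BExp}

theorem mono (h : Runs c s T₁ Q) (hT : T₁ ≤ T₂) (hQ : ∀ s, Q s → Q' s) : Runs c s T₂ Q' :=
  let ⟨t, s', he, ht, hq⟩ := h
  ⟨t, s', he, ht.trans hT, hQ s' hq⟩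

theorem skip (h : Q s) : Runs .skip s 1 Q := ⟨1, s, .skip s, le_rfl, h⟩

theorem setNat {x : ℕ} {e : NExp} (h : Q (s.setNat x (e.eval s))) :
    Runs (.setNat x e) s (e.cost + 1) Q := ⟨_, _, .setNat s x e, le_rfl, h⟩

theorem putNat {a : ℕ} {i e : NExp} (h : Q (s.putNat a (i.eval s) (e.eval s))) :
    Runs (.putNat a i e) s (i.cost + e.cost + 1) Q := ⟨_, _, .putNat s a i e, le_rfl, h⟩

theorem seq (h : Runs c s T₁ fun s' ↦ Runs d s' T₂ Q) : Runs (.seq c d) s (T₁ + T₂) Q :=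
  let ⟨_, _, he, ht, _, s₂, he', ht', hq⟩ := h
  ⟨_, s₂, .seq he he', add_le_add ht ht', hq⟩

theorem ite (hc : b.holds s → Runs c s T₁ Q) (hd : ¬ b.holds s → Runs d s T₂ Q) :
    Runs (.ite b c d) s (b.cost + (T₁ + T₂) + 1) Q := by
  by_cases hb : b.holds s
  · obtain ⟨t, s', he, ht, hq⟩ := hc hb
    exact ⟨_, s', .ite_true hb he, by omega, hq⟩
  · obtain ⟨t, s', he, ht, hq⟩ := hd hb
    exact ⟨_, s', .ite_false hb he, by omega, hq⟩

/-- A loop that is executed `N` times. -/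
theorem loop {N : ℕ} (I : ℕ → State → Prop) (hb : ∀ k s, k ≤ N → I k s → (b.holds s ↔ k < N))
    (hstep : ∀ k s, k < N → I k s → Runs c s T (I (k + 1))) (h0 : I 0 s) :
    Runs (.while b c) s (N * (b.cost + T + 1) + (b.cost + 1)) (I N) := by
  suffices H : ∀ m k s, k + m = N → I k s →
      Runs (.while b c) s (m * (b.cost + T + 1) + (b.cost + 1)) (I N) from
    H N 0 s (zero_add N) h0
  intro m
  induction m with
  | zero =>
    intro k s hk hI
    obtain rfl : k = N := hk
    exact ⟨_, s, .while_false (by simp [hb k s le_rfl hI]), by omega, hI⟩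
  | succ m ih =>
    intro k s hk hI
    obtain ⟨t, s₁, he, ht, hI₁⟩ := hstep k s (by omega) hI
    obtain ⟨t', s₂, he', ht', hI₂⟩ := ih (k + 1) s₁ (by omega) hI₁
    refine ⟨_, s₂, .while_true ((hb k s (by omega) hI).2 (by omega)) he he', ?_, hI₂⟩
    rw [Nat.succ_mul]
    omega

end Runs

/-! ### Expressions for the geometry of the Poincaré ball -/

/-- The square of the Euclidean distance of the points `i` and `j`, over `k` coordinates. -/
def distSqExp (i j : NExp) : ℕ → RExp
  | 0 => .lit 0
  | k + 1 => .add (distSqExp i j k)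
      (.mul (.sub (.get k i) (.get k j)) (.sub (.get k i) (.get k j)))

/-- The square of the Euclidean norm of the point `i`, over `k` coordinates. -/
def normSqExp (i : NExp) : ℕ → RExp
  | 0 => .lit 0
  | k + 1 => .add (normSqExp i k) (.mul (.get k i) (.get k i))

/-- `sinhHalfSq` of the points `i` and `j`. -/
def sinhExp (D : ℕ) (i j : NExp) : RExp :=
  .div (distSqExp i j D)
    (.mul (.sub (.lit 1) (normSqExp i D)) (.sub (.lit 1) (normSqExp j D)))

/-- `PoincareBall.frameDistSq` of the points `a`, `b`, `i` and `j`. -/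
def frameExp (D : ℕ) (a b i j : NExp) : RExp :=
  let e : RExp := .sub (.add (sinhExp D i a) (sinhExp D i b))
    (.add (sinhExp D j a) (sinhExp D j b))
  .add (.mul (.lit 4) (sinhExp D i j)) (.div (.mul e e) (.add (.lit 1) (sinhExp D a b)))

/-- Comparison of `PoincareBall.frameDistSq` of the points `a`, `b`, `i` and `j` with the
threshold for the accuracy in real variable `0`. -/
def nearExp (D : ℕ) (a b i j : NExp) : BExp :=
  .realLe (frameExp D a b i j)
    (.mul (.mul (.div (.var 0) (.lit 44)) (.div (.var 0) (.lit 44))) (sinhExp D a b))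

/-- The real part of the memory holds the input. -/
structure HoldsInput {D n : ℕ} (p : Fin n → PoincareBall D) (ε : ℝ) (s : State) : Prop where
  eps : s.realVar 0 = ε
  arr : s.realArr = (input p ε).realArr
  len : s.natVar 0 = n

section Eval

variable {D n : ℕ} {p : Fin n → PoincareBall D} {ε : ℝ} {s : State}

theorem HoldsInput.setNat (h : HoldsInput p ε s) {x : ℕ} (hx : x ≠ 0) (v : ℕ) :
    HoldsInput p ε (s.setNat x v) :=
  ⟨h.eps, h.arr, by simp [State.setNat, Function.update_of_ne hx.symm, h.len]⟩

theorem HoldsInput.putNat (h : HoldsInput p ε s) (a i v : ℕ) :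
    HoldsInput p ε (s.putNat a i v) :=
  ⟨h.eps, h.arr, h.len⟩

theorem HoldsInput.realArr_eq (h : HoldsInput p ε s) (a : Fin n) (k : Fin D) :
    s.realArr k a = (p a : EuclideanSpace ℝ (Fin D)) k := by
  rw [h.arr]
  simp [input]

theorem eval_distSqExp (i j : NExp) (k : ℕ) : (distSqExp i j k).eval s =
    ∑ l ∈ Finset.range k, (s.realArr l (i.eval s) - s.realArr l (j.eval s)) ^ 2 := by
  induction k with
  | zero => simp [distSqExp, RExp.eval]
  | succ k ih => simp [distSqExp, RExp.eval, ih, Finset.sum_range_succ, sq]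

theorem eval_normSqExp (i : NExp) (k : ℕ) : (normSqExp i k).eval s =
    ∑ l ∈ Finset.range k, s.realArr l (i.eval s) ^ 2 := by
  induction k with
  | zero => simp [normSqExp, RExp.eval]
  | succ k ih => simp [normSqExp, RExp.eval, ih, Finset.sum_range_succ, sq]

theorem eval_sinhExp (h : HoldsInput p ε s) {i j : NExp} {a b : Fin n} (hi : i.eval s = a)
    (hj : j.eval s = b) : (sinhExp D i j).eval s = sinhHalfSq (p a) (p b) := by
  simp only [sinhExp, RExp.eval, eval_distSqExp, eval_normSqExp, hi, hj, Finset.sum_range,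
    h.realArr_eq, sinhHalfSq, EuclideanSpace.real_norm_sq_eq, PiLp.sub_apply, Rat.cast_one]

theorem holds_nearExp (h : HoldsInput p ε s) {ea eb ei ej : NExp} {a b i j : Fin n}
    (ha : ea.eval s = a) (hb : eb.eval s = b) (hi : ei.eval s = i) (hj : ej.eval s = j) :
    (nearExp D ea eb ei ej).holds s ↔ PoincareBall.frameDistSq (p a) (p b) (p i) (p j) ≤
      (ε / 44) ^ 2 * sinhHalfSq (p a) (p b) := by
  simp only [nearExp, BExp.holds, frameExp, RExp.eval, eval_sinhExp h ha hb, eval_sinhExp h hi ha,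
    eval_sinhExp h hi hb, eval_sinhExp h hj ha, eval_sinhExp h hj hb, eval_sinhExp h hi hj, h.eps,
    PoincareBall.frameDistSq, Rat.cast_one, Rat.cast_ofNat, sq]

end Eval

/-! ### Search for a farthest point -/

/-- Test of the loops over all input points, with counter in integer variable `1`. -/
def pointTest : BExp := .natLe (.add (.var 1) (.lit 1)) (.var 0)

/-- Loop body of `farthestCmd`. -/
def farthestStep (D x : ℕ) (o : NExp) : Cmd :=
  .seq (.ite (.realLe (sinhExp D (.var 1) o) (sinhExp D (.var x) o)) .skip (.setNat x (.var 1)))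
    (.setNat 1 (.add (.var 1) (.lit 1)))

/-- Stores in integer variable `x` the index of an input point farthest from the point `o`. -/
def farthestCmd (D x : ℕ) (o : NExp) : Cmd :=
  .seq (.setNat 1 (.lit 0)) (.while pointTest (farthestStep D x o))

/-- Linear scan. The initial value of variable `x` is the first candidate, so it must be a valid
index; `o` is re-evaluated in each round, so it must not depend on the two variables being
overwritten. -/
theorem exists_runs_farthestCmd (D x : ℕ) (o : NExp) (hx0 : x ≠ 0) (hx1 : x ≠ 1) :
    ∃ A : ℕ, ∀ {n : ℕ} {p : Fin n → PoincareBall D} {ε : ℝ} {s : State} (c : Fin n),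
      HoldsInput p ε s → s.natVar x < n →
      (∀ s' : State, (∀ y, y ≠ 1 → y ≠ x → s'.natVar y = s.natVar y) → o.eval s' = c) →
      Runs (farthestCmd D x o) s (A * n + A) fun s' ↦ HoldsInput p ε s' ∧
        (∀ y, y ≠ 1 → y ≠ x → s'.natVar y = s.natVar y) ∧
        ∃ a : Fin n, s'.natVar x = a ∧ ∀ i, sinhHalfSq (p i) (p c) ≤ sinhHalfSq (p a) (p c) := by
  let T : ℕ := ((BExp.realLe (sinhExp D (.var 1) o) (sinhExp D (.var x) o)).cost +
    (1 + (1 + 1)) + 1) + (3 + 1)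
  refine ⟨pointTest.cost + T + 10, fun {n p ε s} c hs hx ho ↦ ?_⟩
  let I : ℕ → State → Prop := fun k s' ↦ HoldsInput p ε s' ∧
    (∀ y, y ≠ 1 → y ≠ x → s'.natVar y = s.natVar y) ∧ s'.natVar 1 = k ∧
    ∃ a : Fin n, s'.natVar x = a ∧
      ∀ i : Fin n, (i : ℕ) < k → sinhHalfSq (p i) (p c) ≤ sinhHalfSq (p a) (p c)
  have hloop : ∀ s', I 0 s' → Runs (.while pointTest (farthestStep D x o)) s' _ (I n) := fun s' h ↦
    Runs.loop (T := T) I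
      (fun k s' _ h ↦ by
        simp only [pointTest, BExp.holds, NExp.eval, h.2.2.1, h.1.len]
        exact Nat.succ_le_iff)
      (fun k s' hk ⟨hs', hy, h1, a, ha, hmax⟩ ↦ by
        have hF := eval_sinhExp hs' (i := .var 1) (a := ⟨k, hk⟩) h1 (ho s' hy)
        have hF' := eval_sinhExp hs' (i := .var x) (a := a) ha (ho s' hy)
        have hlast : ∀ i : Fin n, (i : ℕ) < k + 1 → ¬ (i : ℕ) < k → i = ⟨k, hk⟩ :=
          fun i h₁ h₂ ↦ Fin.ext (by simp only; omega)
        refine Runs.seq (Runs.ite (fun hle ↦ Runs.skip (Runs.setNat ?_))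
          fun hlt ↦ Runs.setNat (Runs.setNat ?_))
        · rw [BExp.holds, hF, hF'] at hle
          refine ⟨hs'.setNat one_ne_zero _, fun y hy1 hyx ↦ ?_, ?_, a, ?_, fun i hi ↦ ?_⟩
          · simp [State.setNat, Function.update_of_ne hy1, hy y hy1 hyx]
          · simp [State.setNat, NExp.eval, h1]
          · simp [State.setNat, Function.update_of_ne hx1, ha]
          · by_cases hik : (i : ℕ) < k
            · exact hmax i hik
            · rwa [hlast i hi hik]
        · rw [BExp.holds, hF, hF', not_le] at hlt
          refine ⟨(hs'.setNat hx0 _).setNat one_ne_zero _, fun y hy1 hyx ↦ ?_, ?_, ⟨k, hk⟩, ?_,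
            fun i hi ↦ ?_⟩
          · simp [State.setNat, Function.update_of_ne hy1, Function.update_of_ne hyx, hy y hy1 hyx]
          · simp [State.setNat, NExp.eval, h1, Function.update_of_ne hx1.symm]
          · simp [State.setNat, Function.update_of_ne hx1, NExp.eval, h1]
          · by_cases hik : (i : ℕ) < k
            · exact (hmax i hik).trans hlt.le
            · rw [hlast i hi hik]) h
  have h0 : I 0 (s.setNat 1 0) := by
    refine ⟨hs.setNat one_ne_zero _, fun y hy1 _ ↦ ?_, ?_, ⟨s.natVar x, hx⟩, ?_, by simp⟩
    · simp [State.setNat, Function.update_of_ne hy1]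
    · simp [State.setNat]
    · simp [State.setNat, Function.update_of_ne hx1]
  refine (Runs.seq (Runs.setNat (hloop _ h0))).mono ?_ ?_
  · simp only [NExp.cost]
    nlinarith
  · rintro s' ⟨hs', hy, -, a, ha, hmax⟩
    exact ⟨hs', hy, a, ha, fun i ↦ hmax i i.2⟩

/-! ### Greedy nets -/

/-- Loop body of the search through the net constructed so far. -/
def searchStep (test : BExp) : Cmd :=
  .seq (.ite test (.setNat 6 (.lit 1)) .skip) (.setNat 3 (.add (.var 3) (.lit 1)))

/-- Test of the search through the net constructed so far. -/
def searchTest : BExp := .natLe (.add (.var 3) (.lit 1)) (.var 2)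

/-- Loop body of `netCmd`: adds the current point to the net unless it is near the net. -/
def netStep (test : BExp) : Cmd :=
  .seq (.setNat 3 (.lit 0)) <| .seq (.setNat 6 (.lit 0)) <|
  .seq (.while searchTest (searchStep test)) <|
  .seq (.ite (.natLe (.var 6) (.lit 0))
    (.seq (.putNat 0 (.var 2) (.var 1)) (.setNat 2 (.add (.var 2) (.lit 1)))) .skip)
  (.setNat 1 (.add (.var 1) (.lit 1)))

/-- Constructs greedily a net of the input points in integer array `0`, with its length in integer
variable `2`. The program `test` decides whether the point with index in variable `1` is near the
point whose index is entry number `j` of the net, where `j` is the value of variable `3`. -/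
def netCmd (test : BExp) : Cmd :=
  .seq (.setNat 1 (.lit 0)) (.while pointTest (netStep test))

/-- The list `out` is separated with respect to `near` and covers the indices below `k`. -/
structure IsNet {n : ℕ} (near : Fin n → Fin n → Prop) (k : ℕ) (out : List (Fin n)) : Prop where
  sep : out.Pairwise fun j i ↦ ¬ near i j
  cover : ∀ i : Fin n, (i : ℕ) < k → ∃ j ∈ out, near i j

/-- Integer array `0` and integer variable `2` hold the list `out`; integer variables `4` and `5`
have the values `a` and `b`, and integer variable `1` has the value `k`. -/
structure HoldsNet {D n : ℕ} (p : Fin n → PoincareBall D) (ε : ℝ) (a b k : ℕ)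
    (out : List (Fin n)) (s : State) : Prop extends HoldsInput p ε s where
  var_one : s.natVar 1 = k
  var_two : s.natVar 2 = out.length
  var_four : s.natVar 4 = a
  var_five : s.natVar 5 = b
  entry : ∀ (j : ℕ) (hj : j < out.length), s.natArr 0 j = out[j]

section Net

variable {D n : ℕ} {p : Fin n → PoincareBall D} {ε : ℝ} {a b k : ℕ} {out : List (Fin n)}
  {s : State} {near : Fin n → Fin n → Prop} {test : BExp}

theorem HoldsNet.setNat (h : HoldsNet p ε a b k out s) {x : ℕ} (h0 : x ≠ 0) (h1 : x ≠ 1)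
    (h2 : x ≠ 2) (h4 : x ≠ 4) (h5 : x ≠ 5) (v : ℕ) : HoldsNet p ε a b k out (s.setNat x v) where
  toHoldsInput := h.toHoldsInput.setNat h0 v
  var_one := by simp [State.setNat, Function.update_of_ne h1.symm, h.var_one]
  var_two := by simp [State.setNat, Function.update_of_ne h2.symm, h.var_two]
  var_four := by simp [State.setNat, Function.update_of_ne h4.symm, h.var_four]
  var_five := by simp [State.setNat, Function.update_of_ne h5.symm, h.var_five]
  entry := h.entry

theorem HoldsNet.incr (h : HoldsNet p ε a b k out s) :
    HoldsNet p ε a b (k + 1) out (s.setNat 1 (k + 1)) where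
  toHoldsInput := h.toHoldsInput.setNat one_ne_zero _
  var_one := by simp [State.setNat]
  var_two := by simp [State.setNat, h.var_two]
  var_four := by simp [State.setNat, h.var_four]
  var_five := by simp [State.setNat, h.var_five]
  entry := h.entry

theorem HoldsNet.push {k : Fin n} (h : HoldsNet p ε a b k out s) :
    HoldsNet p ε a b k (out ++ [k])
      ((s.putNat 0 out.length k).setNat 2 (out.length + 1)) where
  toHoldsInput := (h.toHoldsInput.putNat _ _ _).setNat two_ne_zero _
  var_one := by simp [State.setNat, State.putNat, h.var_one]
  var_two := by simp [State.setNat]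
  var_four := by simp [State.setNat, State.putNat, h.var_four]
  var_five := by simp [State.setNat, State.putNat, h.var_five]
  entry := fun j hj ↦ by
    rw [List.length_append, List.length_singleton] at hj
    rcases (Nat.lt_succ_iff.1 hj).eq_or_lt with rfl | hj'
    · simp [State.setNat, State.putNat]
    · simp [State.setNat, State.putNat, Function.update_of_ne hj'.ne, List.getElem_append_left hj',
        h.entry j hj']

/-- Running time of `netStep` for nets of length at most `M`. -/
def netStepTime (test : BExp) (M : ℕ) : ℕ :=
  (test.cost + 20) * M + 40

theorem runs_netStep {M : ℕ} (hk : k < n)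
    (htest : ∀ s (i j : Fin n), HoldsNet p ε a b i out s → s.natArr 0 (s.natVar 3) = j →
      (test.holds s ↔ near i j))
    (hrefl : ∀ i, near i i) (hM : out.length ≤ M) (hout : IsNet near k out)
    (hs : HoldsNet p ε a b k out s) :
    Runs (netStep test) s (netStepTime test M)
      fun s' ↦ ∃ out', IsNet near (k + 1) out' ∧ HoldsNet p ε a b (k + 1) out' s' := by
  -- Variable 6 is a flag: it stays 0 until a net entry near the current point is met.
  let I : ℕ → State → Prop := fun j s' ↦ HoldsNet p ε a b k out s' ∧ s'.natVar 3 = j ∧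
    (s'.natVar 6 = 0 ↔ ∀ (l : ℕ) (hl : l < out.length), l < j → ¬ near ⟨k, hk⟩ out[l])
  have hstep : ∀ j s', j < out.length → I j s' →
      Runs (searchStep test) s' ((test.cost + (2 + 1) + 1) + 4) (I (j + 1)) := by
    rintro j s' hj ⟨hs', h3, h6⟩
    have ht := htest s' ⟨k, hk⟩ out[j] hs' (by rw [h3, hs'.entry j hj])
    refine Runs.seq (Runs.ite (fun hnear ↦ Runs.setNat (Runs.setNat ?_))
      fun hfar ↦ Runs.skip (Runs.setNat ?_))
    · refine ⟨(hs'.setNat (x := 6) ?_ ?_ ?_ ?_ ?_ _).setNat (x := 3) ?_ ?_ ?_ ?_ ?_ _, ?_, ?_⟩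
      any_goals decide
      · simp [State.setNat, NExp.eval, h3]
      · simp only [State.setNat, NExp.eval, Function.update_self, ne_eq, Nat.reduceEqDiff,
          not_false_eq_true, Function.update_of_ne, one_ne_zero, false_iff, not_forall, not_not]
        exact ⟨j, hj, j.lt_succ_self, ht.1 hnear⟩
    · refine ⟨hs'.setNat (x := 3) ?_ ?_ ?_ ?_ ?_ _, ?_, ?_⟩
      any_goals decide
      · simp [State.setNat, NExp.eval, h3]
      · have : (s'.setNat 3 ((NExp.add (.var 3) (.lit 1)).eval s')).natVar 6 = s'.natVar 6 := by
          simp [State.setNat]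
        rw [this, h6]
        refine ⟨fun h l hl hlj ↦ ?_, fun h l hl hlj ↦ h l hl (hlj.trans j.lt_succ_self)⟩
        rcases (Nat.lt_succ_iff.1 hlj).eq_or_lt with rfl | hlj
        · exact fun hn ↦ hfar (ht.2 hn)
        · exact h l hl hlj
  have hloop : ∀ s', I 0 s' → Runs (.while searchTest (searchStep test)) s' _ (I out.length) :=
    fun s' h ↦ Runs.loop I (fun j s' _ h ↦ by
      simp only [searchTest, BExp.holds, NExp.eval, h.2.1, h.1.var_two]
      exact Nat.succ_le_iff) hstep h
  have h0 : I 0 ((s.setNat 3 0).setNat 6 0) := by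
    refine ⟨(hs.setNat (x := 3) ?_ ?_ ?_ ?_ ?_ _).setNat (x := 6) ?_ ?_ ?_ ?_ ?_ _, ?_, ?_⟩
    any_goals decide
    · simp [State.setNat]
    · simp [State.setNat]
  have hfinish : ∀ s', I out.length s' →
      Runs (.seq (.ite (.natLe (.var 6) (.lit 0))
        (.seq (.putNat 0 (.var 2) (.var 1)) (.setNat 2 (.add (.var 2) (.lit 1)))) .skip)
        (.setNat 1 (.add (.var 1) (.lit 1)))) s' ((3 + ((3 + 4) + 1) + 1) + 4)
        fun s' ↦ ∃ out', IsNet near (k + 1) out' ∧ HoldsNet p ε a b (k + 1) out' s' := by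
    rintro s' ⟨hs', -, h6⟩
    refine Runs.seq (Runs.ite (fun hzero ↦ Runs.seq (Runs.putNat (Runs.setNat (Runs.setNat ?_))))
      fun hone ↦ Runs.skip (Runs.setNat ?_))
    · have hfar := h6.1 (Nat.le_zero.1 hzero)
      refine ⟨out ++ [⟨k, hk⟩], ⟨?_, fun i hi ↦ ?_⟩, ?_⟩
      · rw [List.pairwise_append]
        refine ⟨hout.sep, List.pairwise_singleton _ _, fun j hj i hi ↦ ?_⟩
        rw [List.mem_singleton.1 hi]
        obtain ⟨l, hl, rfl⟩ := List.getElem_of_mem hj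
        exact hfar l hl hl
      · by_cases hik : (i : ℕ) < k
        · obtain ⟨j, hj, hij⟩ := hout.cover i hik
          exact ⟨j, List.mem_append_left _ hj, hij⟩
        · obtain rfl : i = ⟨k, hk⟩ := Fin.ext (by simp only; omega)
          exact ⟨_, List.mem_append_right _ (List.mem_singleton_self _), hrefl _⟩
      · have := (HoldsNet.push (k := ⟨k, hk⟩) hs').incr
        simpa [NExp.eval, State.setNat, State.putNat, hs'.var_one, hs'.var_two] using this
    · have hnear : ∃ j ∈ out, near ⟨k, hk⟩ j := by
        by_contra! h
        exact hone (Nat.le_zero.2 (h6.2 fun l hl _ ↦ h _ (List.getElem_mem hl)))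
      refine ⟨out, ⟨hout.sep, fun i hi ↦ ?_⟩, ?_⟩
      · by_cases hik : (i : ℕ) < k
        · exact hout.cover i hik
        · obtain rfl : i = ⟨k, hk⟩ := Fin.ext (by simp only; omega)
          exact hnear
      · simpa [NExp.eval, hs'.var_one] using hs'.incr
  refine (Runs.seq (Runs.setNat (Runs.seq (Runs.setNat (Runs.seq ((hloop _ h0).mono le_rfl
    hfinish)))))).mono ?_ fun _ h ↦ h
  have hc : searchTest.cost = 5 := rfl
  simp only [netStepTime, NExp.cost, hc]
  nlinarith

/-- The partial net is separated at all times, so the size bound for separated lists also bounds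
every inner search. -/
theorem runs_netCmd {M : ℕ} (hn : s.natVar 2 = 0)
    (htest : ∀ s (i j : Fin n) out, HoldsNet p ε a b i out s → s.natArr 0 (s.natVar 3) = j →
      (test.holds s ↔ near i j))
    (hrefl : ∀ i, near i i)
    (hM : ∀ out : List (Fin n), (out.Pairwise fun j i ↦ ¬ near i j) → out.length ≤ M)
    (hs : HoldsInput p ε s) (h4 : s.natVar 4 = a) (h5 : s.natVar 5 = b) :
    Runs (netCmd test) s (n * (netStepTime test M + 6) + 8)
      fun s' ↦ ∃ out, IsNet near n out ∧ HoldsNet p ε a b n out s' := by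
  have hc : pointTest.cost = 5 := rfl
  have h0 : HoldsNet p ε a b 0 [] (s.setNat 1 0) :=
    { toHoldsInput := hs.setNat one_ne_zero _
      var_one := by simp [State.setNat]
      var_two := by simp [State.setNat, hn]
      var_four := by simp [State.setNat, h4]
      var_five := by simp [State.setNat, h5]
      entry := by simp }
  refine (Runs.seq (Runs.setNat (Runs.loop (N := n) (T := netStepTime test M)
    (fun k s' ↦ ∃ out, IsNet near k out ∧ HoldsNet p ε a b k out s') ?_ ?_
    ⟨[], ⟨List.Pairwise.nil, by simp⟩, h0⟩))).mono ?_ fun _ h ↦ h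
  · rintro k s' - ⟨out, -, h⟩
    simp only [pointTest, BExp.holds, NExp.eval, h.var_one, h.len]
    exact Nat.succ_le_iff
  · rintro k s' hk ⟨out, hout, h⟩
    exact runs_netStep hk (fun s i j ↦ htest s i j out) hrefl (hM out hout.sep) hout h
  · simp only [hc, NExp.cost]
    nlinarith

end Net

end RealRAM

/-! ### Size of separated sets in the frame -/

namespace PoincareBall

variable {D : ℕ}

theorem length_le_of_frameDistSq_separated {ι : Type*} {ε : ℝ} (h0 : 0 < ε) (h1 : ε < 1)
    {p : ι → PoincareBall D} {a b : PoincareBall D}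
    (ha : ∀ i, sinhHalfSq (p i) a ≤ sinhHalfSq a b)
    (hb : ∀ i, sinhHalfSq (p i) b ≤ 4 * sinhHalfSq a b) {out : List ι}
    (hout : out.Pairwise fun j i ↦
      ¬ frameDistSq a b (p i) (p j) ≤ (ε / 44) ^ 2 * sinhHalfSq a b) :
    (out.length : ℝ) ≤ (441 / ε) ^ D := by
  rcases (sinhHalfSq_nonneg a b).eq_or_lt with hab | hab
  · have hp : ∀ i, p i = a := fun i ↦
      eq_of_sinhHalfSq_eq_zero (le_antisymm ((ha i).trans hab.ge) (sinhHalfSq_nonneg _ _))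
    have hlen : out.length ≤ 1 := by
      rcases out with - | ⟨i, - | ⟨j, l⟩⟩
      · simp
      · simp
      · have := (List.pairwise_cons.1 hout).1 j (by simp)
        simp [hp, frameDistSq_self, ← hab] at this
    refine (Nat.cast_le.2 hlen).trans ?_
    rw [Nat.cast_one]
    exact one_le_pow₀ ((one_le_div h0).2 (by linarith))
  · classical
    obtain ⟨x, hx⟩ := exists_frame a b
    have hσ : 0 < √(sinhHalfSq a b) := Real.sqrt_pos.2 hab
    have hσ2 : √(sinhHalfSq a b) ^ 2 = sinhHalfSq a b := Real.sq_sqrt hab.le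
    set σ := √(sinhHalfSq a b)
    have hpos : 0 < ε / 44 * σ := by positivity
    have hsep : (out.map (x ∘ p)).Pairwise fun c d ↦ ε / 44 * σ ≤ ‖c - d‖ := by
      refine List.pairwise_map.2 (hout.imp fun {j i} h ↦ ?_)
      rw [Function.comp_apply, Function.comp_apply, norm_sub_rev]
      refine abs_le_of_sq_le_sq' ?_ (norm_nonneg _) |>.2
      rw [norm_sub_sq_frame hx, mul_pow, hσ2]
      exact (not_le.1 h).le
    have hnodup : (out.map (x ∘ p)).Nodup := hsep.imp fun {c d} h hcd ↦ by
      rw [hcd, sub_self, norm_zero] at h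
      linarith
    have hsymm : ∀ c ∈ out.map (x ∘ p), ∀ d ∈ out.map (x ∘ p), c ≠ d → ε / 44 * σ ≤ ‖c - d‖ :=
      fun c hc d hd hcd ↦ by
        have : Std.Symm fun c d : EuclideanSpace ℝ (Fin D) ↦ ε / 44 * σ ≤ ‖c - d‖ :=
          ⟨fun c d h ↦ by rwa [norm_sub_rev]⟩
        exact hsep.forall hc hd hcd
    have hcard := card_le_of_separated_of_norm_le hpos (R := 5 * σ) (by positivity)
      (out.map (x ∘ p)).toFinset (fun c hc ↦ by
        obtain ⟨i, -, rfl⟩ := List.mem_map.1 (List.mem_toFinset.1 hc)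
        refine abs_le_of_sq_le_sq' ?_ (by positivity) |>.2
        rw [mul_pow, hσ2]
        exact (norm_sq_frame_le hx (ha i) (hb i)).trans (by norm_num))
      (by simpa only [List.mem_toFinset] using hsymm)
    rw [List.toFinset_card_of_nodup hnodup, List.length_map, finrank_euclideanSpace_fin] at hcard
    refine hcard.trans (pow_le_pow_left₀ (by positivity) ?_ D)
    -- The scale σ cancels, which makes the bound independent of P.
    rw [show 2 * (5 * σ) / (ε / 44 * σ) = 440 / ε by field_simp; norm_num,
      show 441 / ε = 1 / ε + 440 / ε by ring]
    gcongr
    exact (one_le_div h0).2 h1.le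

end PoincareBall

/-! ### The coreset program -/

namespace RealRAM

/-- Test whether the point with index in integer variable `1` is near the net point whose position
is in integer variable `3`, in the frame of the points with indices in variables `4` and `5`. -/
def coresetTest (D : ℕ) : BExp := nearExp D (.var 4) (.var 5) (.var 1) (.get 0 (.var 3))

/-- Computes a coreset for farthest-point queries: finds a pair of points that are far apart and
constructs a greedy net in the hyperboloid coordinates centred at their midpoint. -/
def coresetCmd (D : ℕ) : Cmd :=
  .seq (farthestCmd D 4 (.lit 0)) <| .seq (farthestCmd D 5 (.var 4)) <|
  .seq (netCmd (coresetTest D)) (.setNat 0 (.var 2))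

theorem exists_runs_coresetCmd (D : ℕ) :
    ∃ A : ℕ, ∀ {n : ℕ} (p : Fin n → PoincareBall D) {ε : ℝ}, 0 < n → 0 < ε → ε < 1 →
      Runs (coresetCmd D) (input p ε) (A * n * (⌊(441 / ε) ^ D⌋₊ + 1) + A) fun s ↦
        ∃ out : List (Fin n), Outputs s out ∧ (out.length : ℝ) ≤ (441 / ε) ^ D ∧
          ∀ q i, (∀ k, sinhHalfSq q (p k) ≤ sinhHalfSq q (p i)) →
            ∃ j ∈ out, (1 - ε / 4) * sinhHalfSq q (p i) ≤ sinhHalfSq q (p j) := by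
  obtain ⟨A₁, h₁⟩ := exists_runs_farthestCmd D 4 (.lit 0) (by decide) (by decide)
  obtain ⟨A₂, h₂⟩ := exists_runs_farthestCmd D 5 (.var 4) (by decide) (by decide)
  refine ⟨A₁ + A₂ + (coresetTest D).cost + 80, fun {n} p {ε} hn h0 h1 ↦ ?_⟩
  -- This floor occurs only in the analysis; the program never computes the size bound.
  set M := ⌊(441 / ε) ^ D⌋₊
  have hin : HoldsInput p ε (input p ε) := ⟨by simp [input], rfl, by simp [input]⟩
  have hbound : ∀ {a b : Fin n},
      (∀ i, sinhHalfSq (p i) (p ⟨0, hn⟩) ≤ sinhHalfSq (p a) (p ⟨0, hn⟩)) →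
      (∀ i, sinhHalfSq (p i) (p a) ≤ sinhHalfSq (p b) (p a)) →
      (∀ i, sinhHalfSq (p i) (p a) ≤ sinhHalfSq (p a) (p b)) ∧
        ∀ i, sinhHalfSq (p i) (p b) ≤ 4 * sinhHalfSq (p a) (p b) := fun {a b} ha hb ↦
    ⟨fun i ↦ (hb i).trans_eq (PoincareBall.sinhHalfSq_comm _ _), fun i ↦
      PoincareBall.sinhHalfSq_le_four_mul (ha i) (ha b) (hb i)⟩
  refine (Runs.seq ((h₁ ⟨0, hn⟩ hin (by simpa [input]) fun _ _ ↦ rfl).mono le_rfl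
    fun s₁ ⟨hs₁, hv₁, a, ha, hmax₁⟩ ↦
    Runs.seq ((h₂ a hs₁ (by simpa [hv₁, input]) fun s hs ↦ ?_).mono le_rfl
    fun s₂ ⟨hs₂, hv₂, b, hb, hmax₂⟩ ↦
    Runs.seq ((runs_netCmd (a := a) (b := b) (M := M)
      (near := fun i j ↦ PoincareBall.frameDistSq (p a) (p b) (p i) (p j) ≤
        (ε / 44) ^ 2 * sinhHalfSq (p a) (p b))
      ?_ ?_ ?_ ?_ hs₂ ?_ hb).mono le_rfl
    fun s₃ ⟨out, hnet, hs₃⟩ ↦ Runs.setNat ⟨out, ?_, ?_, ?_⟩)))).mono ?_ fun _ h ↦ h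
  · rw [NExp.eval, hs 4 (by decide) (by decide), ha]
  · rw [hv₂ 2 (by decide) (by decide), hv₁ 2 (by decide) (by decide)]
    simp [input]
  · exact fun s i j out hs hj ↦ holds_nearExp hs.toHoldsInput hs.var_four hs.var_five hs.var_one hj
  · intro i
    rw [PoincareBall.frameDistSq_self]
    exact mul_nonneg (sq_nonneg _) (PoincareBall.sinhHalfSq_nonneg _ _)
  · obtain ⟨hbound₁, hbound₂⟩ := hbound hmax₁ hmax₂
    exact fun out hout ↦ Nat.le_floor
      (PoincareBall.length_le_of_frameDistSq_separated h0 h1 hbound₁ hbound₂ hout)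
  · rw [hv₂ 4 (by decide) (by decide), ha]
  · simp only [netStepTime, NExp.cost]
    generalize (coresetTest D).cost = B
    have e : (A₁ + A₂ + B + 80) * n * (M + 1) + (A₁ + A₂ + B + 80) =
        (A₁ * n + A₁) + (A₂ * n + A₂) + (n * ((B + 20) * M + 40 + 6) + 8) + 2 +
        (A₁ * n * M + A₂ * n * M + 60 * n * M + B * n + 34 * n + B + 70) := by ring
    omega
  · exact ⟨by simp [State.setNat, NExp.eval, hs₃.var_two], fun j ↦ hs₃.entry j j.2⟩
  · obtain ⟨hbound₁, hbound₂⟩ := hbound hmax₁ hmax₂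
    exact PoincareBall.length_le_of_frameDistSq_separated h0 h1 hbound₁ hbound₂ hnet.sep
  · obtain ⟨hbound₁, hbound₂⟩ := hbound hmax₁ hmax₂
    intro q i hq
    obtain ⟨j, hj, hij⟩ := hnet.cover i i.2
    exact ⟨j, hj, PoincareBall.sinhHalfSq_ge_of_frameDistSq_le h0 (hbound₁ i) (hbound₂ i)
      (hbound₁ j) (hbound₂ j) (hq a) (hq b) hij⟩

end RealRAM

/-! ### The main theorem -/

theorem theorem1 (D : ℕ) :
    ∃ (prog : RealRAM.Cmd) (C : ℝ), 0 < C ∧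
      ∀ (ε : ℝ) (n : ℕ) (p : Fin n → PoincareBall D),
        0 < ε → ε < 1 → 0 < n → Function.Injective p →
        ∃ (t : ℕ) (s : RealRAM.State) (out : List (Fin n)) (Pε : Set (PoincareBall D)),
          RealRAM.Exec prog (RealRAM.input p ε) t s ∧
          RealRAM.Outputs s out ∧
          Pε = p '' {i | i ∈ out} ∧
          (t : ℝ) ≤ C * (n / ε ^ D) ∧
          (out.length : ℝ) ≤ C * (1 / ε ^ D) ∧
          Pε ⊆ Set.range p ∧
          (Pε.ncard : ℝ) ≤ C * (1 / ε ^ D) ∧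
          ∀ q f : PoincareBall D, IsFarthest (Set.range p) q f →
            ∃ pε ∈ Pε,
              hypDist q pε ≥ hypDist q f - ε ∧
              hypDist q pε ≥ (1 - ε) * hypDist q f := by
  obtain ⟨A, hA⟩ := RealRAM.exists_runs_coresetCmd D
  -- The 2 absorbs the +1 per point and the additive A, using 1 ≤ 1/ε^D and 1 ≤ n; A + 1 instead of
  -- A also covers the size bound.
  refine ⟨RealRAM.coresetCmd D, (A + 1) * (441 ^ D + 2), by positivity,
    fun ε n p h0 h1 hn _ ↦ ?_⟩
  obtain ⟨t, s, hexec, ht, out, hout, hlen, hcov⟩ := hA p hn h0 h1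
  have hε : (1 : ℝ) ≤ 1 / ε ^ D :=
    (one_le_div (pow_pos h0 D)).2 (pow_le_one₀ h0.le h1.le)
  have hlen' : (out.length : ℝ) ≤ (A + 1) * (441 ^ D + 2) * (1 / ε ^ D) := by
    refine hlen.trans ?_
    rw [div_pow, div_eq_mul_one_div]
    refine mul_le_mul_of_nonneg_right ?_ (zero_le_one.trans hε)
    have hA0 : (0 : ℝ) ≤ A := A.cast_nonneg
    nlinarith [pow_pos (show (0 : ℝ) < 441 by norm_num) D]
  refine ⟨t, s, out, p '' {i | i ∈ out}, hexec, hout, rfl, ?_, hlen', Set.image_subset_range _ _,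
    ?_, ?_⟩
  · have hA0 : (0 : ℝ) ≤ A := A.cast_nonneg
    have hn1 : (1 : ℝ) ≤ n := Nat.one_le_cast.2 hn
    have hM : (⌊(441 / ε) ^ D⌋₊ : ℝ) ≤ 441 ^ D * (1 / ε ^ D) := by
      refine (Nat.floor_le (by positivity)).trans_eq ?_
      rw [div_pow, div_eq_mul_one_div]
    have ht' : (t : ℝ) ≤ A * n * (⌊(441 / ε) ^ D⌋₊ + 1) + A := by exact_mod_cast ht
    rw [div_eq_mul_one_div (n : ℝ)]
    set E := 1 / ε ^ D
    calc (t : ℝ) ≤ A * n * (441 ^ D * E + E) + A * (n * E) := by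
          refine ht'.trans (add_le_add ?_ (le_mul_of_one_le_right hA0
            (one_le_mul_of_one_le_of_one_le hn1 hε)))
          gcongr
      _ = A * (441 ^ D + 2) * (n * E) := by ring
      _ ≤ (A + 1) * (441 ^ D + 2) * (n * E) := by
          gcongr
          linarith
  · refine le_trans (Nat.cast_le.2 ?_) hlen'
    classical
    rw [show {i | i ∈ out} = (out.toFinset : Set (Fin n)) by ext; simp]
    exact (Set.ncard_image_le (Finset.finite_toSet _)).trans
      ((Set.ncard_coe_finset _).trans_le out.toFinset_card_le)
  · rintro q f ⟨⟨i, rfl⟩, hf⟩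
    obtain ⟨j, hj, hij⟩ := hcov q i fun k ↦
      (PoincareBall.hypDist_le_hypDist_iff q (p k) q (p i)).1 (hf _ ⟨k, rfl⟩)
    exact ⟨p j, ⟨j, hj, rfl⟩, PoincareBall.hypDist_approx h0 h1 hij⟩
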